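/- Let $K$ be a finite-dimensional complex Hilbert space. Let $\{X_{i,\alpha}\}$ ($i\in I$, $\alpha\in S_i$) and $\{Y_{j,\beta}\}$ ($j\in J$, $\beta\in T_j$) be finite families of positive (semidefinite) operators on $K$ such that $$[X_{i,\alpha},Y_{j,\beta}]=0\quad\text{for all } i,j,\alpha,\beta,$$ $\sum_{\alpha\in S_i} X_{i,\alpha}=\mathrm{id}_K$ for every $i$, and $\sum_{\beta\in T_j} Y_{j,\beta}=\mathrm{id}_K$ for every $j$. Then there exist finite-dimensional complex Hilbert spaces $K_A$ and $K_B$, an isometry $V\colon K\to K_A\otimes K_B$, operators $A_{i,\alpha}$ on $K_A$ and operators $B_{j,\beta}$ on $K_B$ such that, for all $i,j,\alpha,\beta$, $$X_{i,\alpha}=V^*\bigl(A_{i,\alpha}\otimes\mathrm{id}_{K_B}\bigr)V,\qquad Y_{j,\beta}=V^*\bigl(\mathrm{id}_{K_A}\otimes B_{j,\beta}\bigr)V .$$ Moreover, these can be chosen so that all $A_{i,\alpha}$ and $B_{j,\beta}$ are positive, $\sum_{\alpha}A_{i,\alpha}=\mathrm{id}_{K_A}$ for every $i$, $\sum_{\beta}B_{j,\beta}=\mathrm{id}_{K_B}$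 for every $j$, and $$X_{i,\alpha}Y_{j,\beta}=V^*\bigl(A_{i,\alpha}\otimes B_{j,\beta}\bigr)V .$$ -/

import Mathlib

open scoped TensorProduct InnerProductSpace

universe u

/-! Take K_A = K with A = X, and let K_B be the commutant N of the X's with the Hilbert-Schmidt
inner product, on which B acts as left multiplication by Y. Evaluation W : K ⊗ N → K, k ⊗ n ↦ n k,
is onto because 1 ∈ N, and it intertwines x ⊗ L_y with x y because n commutes with x. Its polar part
V = W*(WW*)^(-1/2) is an isometry. The operators and their adjoints are both intertwined, so WW*
commutes with x y, and compression by V returns x y exactly. -/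

/-- A positive invertible operator has a self-adjoint inverse square root, which commutes with
everything that commutes with the operator. -/
theorem LinearMap.IsPositive.exists_inv_sqrt {K : Type*} [NormedAddCommGroup K]
    [InnerProductSpace ℂ K] [FiniteDimensional ℂ K] {P : K →ₗ[ℂ] K} (hP : P.IsPositive)
    (hinj : Function.Injective P) :
    ∃ s : K →ₗ[ℂ] K, s.adjoint = s ∧ s ∘ₗ P ∘ₗ s = LinearMap.id ∧
      ∀ T : K →ₗ[ℂ] K, P ∘ₗ T = T ∘ₗ P → s ∘ₗ T = T ∘ₗ s := by
  have := FiniteDimensional.complete ℂ K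
  let e : (K →ₗ[ℂ] K) ≃ₐ[ℂ] (K →L[ℂ] K) := Module.End.toContinuousLinearMap K
  have ha : 0 ≤ e P := by
    rw [ContinuousLinearMap.nonneg_iff_isPositive]
    exact (LinearMap.isPositive_toContinuousLinearMap_iff P).2 hP
  have hu : IsUnit (e P) := by
    rw [isUnit_map_iff]
    exact (Module.End.isUnit_iff P).2
      ⟨hinj, LinearMap.injective_iff_surjective.1 hinj⟩
  set r := CFC.sqrt (e P)
  have hrr : r * r = e P := CFC.sqrt_mul_sqrt_self (e P) ha
  have hru : IsUnit r := by
    refine ((Commute.refl r).isUnit_mul_iff.1 ?_).1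
    rwa [hrr]
  obtain ⟨u, hur⟩ := hru
  have hsa : star (↑u⁻¹ : K →L[ℂ] K) = ↑u⁻¹ := by
    have hrs : IsSelfAdjoint r := (CFC.sqrt_nonneg (e P)).isSelfAdjoint
    have : star u = u := Units.ext (by rw [Units.coe_star, hur]; exact hrs)
    rw [← Units.coe_star, star_inv, this]
  refine ⟨e.symm ↑u⁻¹, ?_, ?_, fun T hT => ?_⟩
  · apply e.injective
    rw [e.apply_symm_apply]
    conv_rhs => rw [← hsa]
    rfl
  · apply e.injective
    change e (e.symm ↑u⁻¹ * (P * e.symm ↑u⁻¹)) = e 1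
    rw [map_mul, map_mul, map_one, e.apply_symm_apply, ← hrr, ← hur]
    simp [mul_assoc]
  · have hc : Commute (e P) (e T) := (show Commute P T from hT).map e
    -- The square root is a functional calculus of `e P`, hence commutes with whatever `e P` does.
    have hc' : Commute r (e T) := hc.cfcₙ_nnreal NNReal.sqrt
    rw [← hur] at hc'
    have h := hc'.units_inv_left
    apply e.injective
    change e (e.symm ↑u⁻¹ * T) = e (T * e.symm ↑u⁻¹)
    rw [map_mul, map_mul, e.apply_symm_apply]
    exact h

/-- The adjoint of a surjection can be normalised to an isometry which compresses every operator
lifting a `*`-intertwined one back to it. -/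
theorem LinearMap.exists_isometry_of_surjective {H K : Type*} [NormedAddCommGroup K]
    [InnerProductSpace ℂ K] [FiniteDimensional ℂ K] [NormedAddCommGroup H]
    [InnerProductSpace ℂ H] [FiniteDimensional ℂ H] (W : H →ₗ[ℂ] K)
    (hW : Function.Surjective W) :
    ∃ V : K →ₗᵢ[ℂ] H, ∀ (T : K →ₗ[ℂ] K) (R : H →ₗ[ℂ] H), W ∘ₗ R = T ∘ₗ W →
      W ∘ₗ R.adjoint = T.adjoint ∘ₗ W →
      T = V.toLinearMap.adjoint ∘ₗ R ∘ₗ V.toLinearMap := by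
  have hinj : Function.Injective (W ∘ₗ W.adjoint) := by
    rw [LinearMap.injective_iff_surjective, ← LinearMap.range_eq_top,
      LinearMap.range_self_comp_adjoint, LinearMap.range_eq_top]
    exact hW
  obtain ⟨s, hs, hsP, hsc⟩ := (LinearMap.isPositive_self_comp_adjoint W).exists_inv_sqrt hinj
  have hadj : (W.adjoint ∘ₗ s).adjoint = s ∘ₗ W := by
    rw [LinearMap.adjoint_comp, LinearMap.adjoint_adjoint, hs]
  have hiso (x : K) : ‖(W.adjoint ∘ₗ s) x‖ = ‖x‖ := by
    have : inner ℂ ((W.adjoint ∘ₗ s) x) ((W.adjoint ∘ₗ s) x) = inner ℂ x x := by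
      rw [← LinearMap.adjoint_inner_right, hadj]
      exact congr(inner ℂ x ($hsP x))
    rw [inner_self_eq_norm_sq_to_K, inner_self_eq_norm_sq_to_K] at this
    exact (sq_eq_sq₀ (norm_nonneg _) (norm_nonneg _)).1 (by exact_mod_cast this)
  refine ⟨⟨W.adjoint ∘ₗ s, hiso⟩, fun T R h1 h2 => ?_⟩
  have h3 : R ∘ₗ W.adjoint = W.adjoint ∘ₗ T := by
    simpa [LinearMap.adjoint_comp] using congr(LinearMap.adjoint $h2)
  -- WW*T = WRW* = TWW*, so T also commutes with s = (WW*)^(-1/2).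
  have hT : s ∘ₗ T = T ∘ₗ s := hsc T <| by
    rw [LinearMap.comp_assoc, ← h3, ← LinearMap.comp_assoc, h1, LinearMap.comp_assoc]
  change T = (W.adjoint ∘ₗ s).adjoint ∘ₗ R ∘ₗ W.adjoint ∘ₗ s
  calc T = (s ∘ₗ (W ∘ₗ W.adjoint) ∘ₗ s) ∘ₗ T := by rw [hsP, LinearMap.id_comp]
    _ = (s ∘ₗ W) ∘ₗ W.adjoint ∘ₗ s ∘ₗ T := rfl
    _ = (s ∘ₗ W) ∘ₗ (W.adjoint ∘ₗ T) ∘ₗ s := by rw [hT]; rfl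
    _ = (W.adjoint ∘ₗ s).adjoint ∘ₗ R ∘ₗ W.adjoint ∘ₗ s := by rw [hadj, ← h3]; rfl

section Commutant

variable {K : Type*} [NormedAddCommGroup K] [InnerProductSpace ℂ K] {ι : Type*} [Fintype ι]

/-- The operator sending the `i`-th basis vector to the `i`-th entry of a tuple. The Hilbert sum
norm on tuples corresponds to the Hilbert-Schmidt norm on operators. -/
noncomputable def OrthonormalBasis.tupleToEnd (b : OrthonormalBasis ι ℂ K) :
    PiLp 2 (fun _ : ι => K) →ₗ[ℂ] Module.End ℂ K :=
  (b.toBasis.constr ℂ).toLinearMap ∘ₗ (WithLp.linearEquiv 2 ℂ (ι → K)).toLinearMap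

theorem OrthonormalBasis.tupleToEnd_apply_self (b : OrthonormalBasis ι ℂ K)
    (f : PiLp 2 (fun _ : ι => K)) (i : ι) : b.tupleToEnd f (b i) = f i := by
  have := b.toBasis.constr_basis ℂ (WithLp.linearEquiv 2 ℂ (ι → K) f) i
  rwa [b.coe_toBasis] at this

/-- Apply an operator to each entry of a tuple. -/
noncomputable def PiLp.mapEnd (ι : Type*) [Fintype ι] (y : K →ₗ[ℂ] K) :
    PiLp 2 (fun _ : ι => K) →ₗ[ℂ] PiLp 2 (fun _ : ι => K) where
  toFun f := WithLp.toLp 2 fun i => y (f i)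
  map_add' f g := by ext i; simp
  map_smul' c f := by ext i; simp

theorem PiLp.mapEnd_apply (y : K →ₗ[ℂ] K) (f : PiLp 2 (fun _ : ι => K)) (i : ι) :
    PiLp.mapEnd ι y f i = y (f i) := rfl

theorem OrthonormalBasis.tupleToEnd_mapEnd (b : OrthonormalBasis ι ℂ K) (y : K →ₗ[ℂ] K)
    (f : PiLp 2 (fun _ : ι => K)) : b.tupleToEnd (PiLp.mapEnd ι y f) = y ∘ₗ b.tupleToEnd f := by
  refine b.toBasis.ext fun i => ?_
  rw [b.coe_toBasis, LinearMap.comp_apply, b.tupleToEnd_apply_self, b.tupleToEnd_apply_self,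
    PiLp.mapEnd_apply]

/-- The commutant of a set of operators, as a space of tuples. -/
noncomputable def OrthonormalBasis.commutant (b : OrthonormalBasis ι ℂ K)
    (Z : Set (Module.End ℂ K)) : Submodule ℂ (PiLp 2 (fun _ : ι => K)) :=
  (Subalgebra.centralizer ℂ Z).toSubmodule.comap b.tupleToEnd

theorem OrthonormalBasis.mem_commutant {b : OrthonormalBasis ι ℂ K} {Z : Set (Module.End ℂ K)}
    {f : PiLp 2 (fun _ : ι => K)} :
    f ∈ b.commutant Z ↔ b.tupleToEnd f ∈ Subalgebra.centralizer ℂ Z := Iff.rfl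

/-- Left multiplication on the commutant by one of its elements. -/
noncomputable def OrthonormalBasis.commutantMul (b : OrthonormalBasis ι ℂ K)
    {Z : Set (Module.End ℂ K)} (y : Module.End ℂ K) (hy : y ∈ Subalgebra.centralizer ℂ Z) :
    b.commutant Z →ₗ[ℂ] b.commutant Z :=
  (PiLp.mapEnd ι y).restrict fun f hf => by
    rw [b.mem_commutant, b.tupleToEnd_mapEnd]
    exact mul_mem hy hf

theorem OrthonormalBasis.coe_commutantMul_apply (b : OrthonormalBasis ι ℂ K)
    {Z : Set (Module.End ℂ K)} {y : Module.End ℂ K} (hy : y ∈ Subalgebra.centralizer ℂ Z)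
    (f : b.commutant Z) (i : ι) :
    (b.commutantMul y hy f : PiLp 2 (fun _ : ι => K)) i = y ((f : PiLp 2 (fun _ : ι => K)) i) :=
  rfl

/-- The inner product is a sum over entries and y acts entrywise, so positivity is inherited term by
term. -/
theorem OrthonormalBasis.isPositive_commutantMul (b : OrthonormalBasis ι ℂ K)
    {Z : Set (Module.End ℂ K)} {y : Module.End ℂ K} (hy : y ∈ Subalgebra.centralizer ℂ Z)
    (hpos : LinearMap.IsPositive y) : (b.commutantMul y hy).IsPositive := by
  refine ⟨fun f g => ?_, fun f => ?_⟩
  · simp only [Submodule.coe_inner, PiLp.inner_apply, b.coe_commutantMul_apply]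
    exact Finset.sum_congr rfl fun i _ => hpos.isSymmetric _ _
  · simp only [Submodule.coe_inner, PiLp.inner_apply, b.coe_commutantMul_apply, map_sum]
    exact Finset.sum_nonneg fun i _ => hpos.re_inner_nonneg_left _

/-- Evaluation of elements of the commutant at vectors. -/
noncomputable def OrthonormalBasis.commutantEval (b : OrthonormalBasis ι ℂ K)
    (Z : Set (Module.End ℂ K)) : K ⊗[ℂ] b.commutant Z →ₗ[ℂ] K :=
  TensorProduct.lift (b.tupleToEnd ∘ₗ (b.commutant Z).subtype).flip

theorem OrthonormalBasis.commutantEval_tmul (b : OrthonormalBasis ι ℂ K)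
    (Z : Set (Module.End ℂ K)) (k : K) (f : b.commutant Z) :
    b.commutantEval Z (k ⊗ₜ f) = b.tupleToEnd (f : PiLp 2 (fun _ : ι => K)) k := rfl

theorem OrthonormalBasis.commutantEval_surjective (b : OrthonormalBasis ι ℂ K)
    (Z : Set (Module.End ℂ K)) : Function.Surjective (b.commutantEval Z) := fun k => by
  have h1 : b.tupleToEnd (WithLp.toLp 2 b) = 1 := b.toBasis.ext fun i => by
    rw [b.coe_toBasis, b.tupleToEnd_apply_self, Module.End.one_apply]
  refine ⟨k ⊗ₜ ⟨WithLp.toLp 2 b, ?_⟩, ?_⟩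
  · rw [b.mem_commutant, h1]
    exact one_mem _
  · rw [b.commutantEval_tmul, h1, Module.End.one_apply]

/-- Both n and y commute with x, so (y n)(x k) = x y (n k). Adjoining the identity to Z covers the
case of Y alone. -/
theorem OrthonormalBasis.commutantEval_comp_map (b : OrthonormalBasis ι ℂ K)
    {Z : Set (Module.End ℂ K)} {x y : Module.End ℂ K} (hx : x ∈ Z ∪ {LinearMap.id})
    (hy : y ∈ Subalgebra.centralizer ℂ Z) :
    b.commutantEval Z ∘ₗ TensorProduct.map x (b.commutantMul y hy) =
      (x ∘ₗ y) ∘ₗ b.commutantEval Z := by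
  refine TensorProduct.ext' fun k f => ?_
  have hxc {n : Module.End ℂ K} (hn : n ∈ Subalgebra.centralizer ℂ Z) (v : K) :
      n (x v) = x (n v) := by
    rcases hx with hx | rfl
    · exact congr($(Subalgebra.mem_centralizer_iff ℂ |>.1 hn x hx) v).symm
    · rfl
  have hm : b.tupleToEnd (b.commutantMul y hy f : PiLp 2 (fun _ : ι => K)) =
      y ∘ₗ b.tupleToEnd (f : PiLp 2 (fun _ : ι => K)) := b.tupleToEnd_mapEnd y f
  simp only [LinearMap.comp_apply, TensorProduct.map_tmul, b.commutantEval_tmul, hm]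
  rw [hxc f.2, hxc hy]

end Commutant

theorem mainTheorem4
    {K : Type u} [NormedAddCommGroup K] [InnerProductSpace ℂ K] [FiniteDimensional ℂ K]
    {I : Type*} {J : Type*} [Fintype I] [Fintype J]
    {S : I → Type*} {T : J → Type*} [∀ i, Fintype (S i)] [∀ j, Fintype (T j)]
    (X : ∀ i, S i → K →ₗ[ℂ] K) (Y : ∀ j, T j → K →ₗ[ℂ] K)
    (hX : ∀ i α, (X i α).IsPositive) (hY : ∀ j β, (Y j β).IsPositive)
    (hXY : ∀ i α j β, X i α ∘ₗ Y j β = Y j β ∘ₗ X i α)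
    (hX1 : ∀ i, ∑ α, X i α = LinearMap.id) (hY1 : ∀ j, ∑ β, Y j β = LinearMap.id) :
    ∃ (KA : Type u) (_ : NormedAddCommGroup KA) (_ : InnerProductSpace ℂ KA)
      (_ : FiniteDimensional ℂ KA)
      (KB : Type u) (_ : NormedAddCommGroup KB) (_ : InnerProductSpace ℂ KB)
      (_ : FiniteDimensional ℂ KB)
      (V : K →ₗᵢ[ℂ] KA ⊗[ℂ] KB)
      (A : ∀ i, S i → KA →ₗ[ℂ] KA) (B : ∀ j, T j → KB →ₗ[ℂ] KB),
      (∀ i α, (A i α).IsPositive) ∧ (∀ i, ∑ α, A i α = LinearMap.id) ∧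
      (∀ j β, (B j β).IsPositive) ∧ (∀ j, ∑ β, B j β = LinearMap.id) ∧
      (∀ i α, X i α = V.toLinearMap.adjoint ∘ₗ
        TensorProduct.map (A i α) LinearMap.id ∘ₗ V.toLinearMap) ∧
      (∀ j β, Y j β = V.toLinearMap.adjoint ∘ₗ
        TensorProduct.map LinearMap.id (B j β) ∘ₗ V.toLinearMap) ∧
      (∀ i α j β, X i α ∘ₗ Y j β = V.toLinearMap.adjoint ∘ₗ
        TensorProduct.map (A i α) (B j β) ∘ₗ V.toLinearMap) := by
  have hYc (j β) : Y j β ∈ Subalgebra.centralizer ℂ {x : Module.End ℂ K | ∃ i α, x = X i α} := by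
    rw [Subalgebra.mem_centralizer_iff]
    rintro _ ⟨i, α, rfl⟩
    exact hXY i α j β
  generalize hZ : {x : Module.End ℂ K | ∃ i α, x = X i α} = Z at hYc
  have hXZ (i α) : X i α ∈ Z := hZ ▸ ⟨i, α, rfl⟩
  let b := stdOrthonormalBasis ℂ K
  obtain ⟨V, hV⟩ := LinearMap.exists_isometry_of_surjective
    (H := K ⊗[ℂ] b.commutant Z) (b.commutantEval Z)
    (b.commutantEval_surjective Z)
  have hB (j β) := b.isPositive_commutantMul (hYc j β) (hY j β)
  have key {x y : Module.End ℂ K} (hx : x ∈ Z ∪ {LinearMap.id})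
      (hy : y ∈ Subalgebra.centralizer ℂ Z) (hxp : LinearMap.IsPositive x)
      (hyp : LinearMap.IsPositive y) (hc : x ∘ₗ y = y ∘ₗ x) :
      x ∘ₗ y = V.toLinearMap.adjoint ∘ₗ
        TensorProduct.map x (b.commutantMul y hy) ∘ₗ V.toLinearMap := by
    -- Since x and y are commuting and self-adjoint, so are x y and x ⊗ L_y self-adjoint; the
    -- adjoint condition is the same intertwining again.
    refine hV _ _ (b.commutantEval_comp_map hx hy) ?_
    rw [TensorProduct.adjoint_map, hxp.adjoint_eq, (b.isPositive_commutantMul hy hyp).adjoint_eq,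
      LinearMap.adjoint_comp, hxp.adjoint_eq, hyp.adjoint_eq, ← hc]
    exact b.commutantEval_comp_map hx hy
  refine ⟨K, inferInstance, inferInstance, inferInstance, b.commutant Z, inferInstance,
    inferInstance, inferInstance, V, X, fun j β => b.commutantMul (Y j β) (hYc j β), hX, hX1,
    hB, fun j => ?_, fun i α => ?_, fun j β => ?_, fun i α j β => ?_⟩
  · ext f i
    simp only [LinearMap.sum_apply, Submodule.coe_sum, WithLp.ofLp_sum, Finset.sum_apply,
      b.coe_commutantMul_apply]
    exact (LinearMap.sum_apply _ _ _).symm.trans congr($(hY1 j) _)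
  · exact key (.inl (hXZ i α)) (one_mem _) (hX i α) LinearMap.isPositive_id rfl
  · exact key (.inr rfl) (hYc j β) LinearMap.isPositive_id (hY j β) rfl
  · exact key (.inl (hXZ i α)) (hYc j β) (hX i α) (hY j β) (hXY i α j β)
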